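/- Let $U=\{x\in\mathbb{R}^2:\|x\|\le 1\}$ be the closed unit disc centred at the origin. Let $B\subseteq\mathbb{R}^2$ be a rectifiable set, i.e. a union of at most countably many rectifiable curves (traces of continuous paths of finite length), and suppose that $B$ is a barrier of $U$, i.e. every line that intersects $U$ also intersects $B$. For a plane set $A$ let $|A|\in[0,\infty]$ denote its length (one-dimensional Hausdorff measure). Then for every real $r\ge 0$, with $B_{\mathrm{out}}=B\setminus (1+r)U$, $$|B|-\pi\ \ge\ \frac{r}{1+r}\,|B_{\mathrm{out}}|,$$ where this is read as $|B|\ge \pi+\frac{r}{1+r}|B_{\mathrm{out}}|$ in $[0,\infty]$, with $0\cdot\infty=0$. -/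

import Mathlib

open scoped Pointwise

/-- The Euclidean plane. -/
abbrev Plane : Type := EuclideanSpace ℝ (Fin 2)

/-- The closed unit disc centred at the origin. -/
def unitDisc : Set Plane := Metric.closedBall 0 1

/-- `B` is a barrier (opaque set) for `K`: every line of the plane that meets `K` also meets `B`.
A line is an affine subspace whose direction is one-dimensional. -/
def IsBarrier (B K : Set Plane) : Prop :=
  ∀ l : AffineSubspace ℝ Plane, Module.finrank ℝ l.direction = 1 →
    ((l : Set Plane) ∩ K).Nonempty → ((l : Set Plane) ∩ B).Nonempty

/-- A rectifiable curve: the trace of a continuous path of finite length. -/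
def IsRectifiableCurve (C : Set Plane) : Prop :=
  ∃ γ : ℝ → Plane, ContinuousOn γ (Set.Icc 0 1) ∧ BoundedVariationOn γ (Set.Icc 0 1) ∧
    C = γ '' Set.Icc 0 1

/-- A rectifiable set: a union of at most countably many rectifiable curves. -/
def IsRectifiable (B : Set Plane) : Prop :=
  ∃ S : Set (Set Plane), S.Countable ∧ (∀ C ∈ S, IsRectifiableCurve C) ∧ B = ⋃₀ S

/-- The length of a plane set: its one-dimensional Hausdorff measure (possibly infinite). -/
noncomputable def setLength (B : Set Plane) : ENNReal := MeasureTheory.Measure.hausdorffMeasure 1 B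

/-- The part of `B` outside the closed disc `(1 + r) U`. -/
def outerPart (B : Set Plane) (r : ℝ) : Set Plane := B \ ((1 + r) • unitDisc)

open MeasureTheory Set
open scoped ENNReal NNReal

/-! Project `B` onto each direction `θ`. The barrier property makes the projection cover `[-1, 1]`,
so integrating over a half turn gives at least `2π`. Conversely, a length element at `x` with unit
tangent `v` contributes at most `∫ |⟨v, unitVec θ⟩|`, taken over those `θ` whose normal line through
`x` meets the disc. This is at most 2 for every `x`. If `‖x‖ ≥ 1 + r`, the admissible `θ` have
measure at most `2 arcsin (1/(1+r))`, which bounds the integral by `2/(1+r)`. Hence `π ≤ |B \ B_out|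
+ |B_out|/(1+r)`, which rearranges to the claim. Tangents are replaced by a countable cover by
nearly straight pieces, with error `ε → 0`. The two halves are `lintegral_indicator_abs_sin_le` and
`exists_measurable_bound_hitOffsets`. -/

/-! ### Integrals of `|cos|` over a set of directions. -/

/-- On a half period, the part of `|cos|` above the level `cos (arcsin s)`. -/
theorem integral_max_abs_cos_sub {s : ℝ} (hs0 : 0 ≤ s) (hs1 : s ≤ 1) (b : ℝ) :
    ∫ θ in (0 : ℝ)..Real.pi, max (|Real.cos (θ - b)| - Real.cos (Real.arcsin s)) 0
      = 2 * s - 2 * Real.arcsin s * Real.cos (Real.arcsin s) := by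
  set α := Real.arcsin s with hα
  have hα0 : 0 ≤ α := Real.arcsin_nonneg.2 hs0
  have hα1 : α ≤ Real.pi / 2 := Real.arcsin_le_pi_div_two s
  set h : ℝ → ℝ := fun t => max (|Real.cos t| - Real.cos α) 0 with hh
  have hcont : Continuous h := by fun_prop
  have hper : Function.Periodic h Real.pi := fun t => by simp [hh, Real.cos_add_pi]
  have e1 : ∫ θ in (0 : ℝ)..Real.pi, h (θ - b) = ∫ t in (-(Real.pi / 2))..(Real.pi / 2), h t := by
    rw [intervalIntegral.integral_comp_sub_right]
    have := hper.intervalIntegral_add_eq (0 - b) (-(Real.pi / 2))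
    convert this using 2 <;> ring
  have i1 : ∀ u v, IntervalIntegrable h volume u v := fun u v => hcont.intervalIntegrable u v
  have z1 : ∫ t in (-(Real.pi / 2))..(-α), h t = 0 := by
    rw [intervalIntegral.integral_congr (g := fun _ => 0)]
    · simp
    intro t ht
    rw [uIcc_of_le (by linarith)] at ht
    have h1 : Real.cos t ≤ Real.cos α := by
      rw [← Real.cos_neg t]
      exact Real.cos_le_cos_of_nonneg_of_le_pi hα0 (by linarith [ht.1, Real.pi_pos]) (by linarith [ht.2])
    have h2 : 0 ≤ Real.cos t := Real.cos_nonneg_of_mem_Icc ⟨by linarith [ht.1], by linarith [ht.2]⟩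
    simp [hh, abs_of_nonneg h2, h1]
  have z2 : ∫ t in α..(Real.pi / 2), h t = 0 := by
    rw [intervalIntegral.integral_congr (g := fun _ => 0)]
    · simp
    intro t ht
    rw [uIcc_of_le (by linarith)] at ht
    have h1 : Real.cos t ≤ Real.cos α :=
      Real.cos_le_cos_of_nonneg_of_le_pi hα0 (by linarith [ht.2, Real.pi_pos]) ht.1
    have h2 : 0 ≤ Real.cos t := Real.cos_nonneg_of_mem_Icc ⟨by linarith [ht.1], by linarith [ht.2]⟩
    simp [hh, abs_of_nonneg h2, h1]
  have z3 : ∫ t in (-α)..α, h t = 2 * s - 2 * α * Real.cos α := by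
    rw [intervalIntegral.integral_congr (g := fun t => Real.cos t - Real.cos α)]
    · rw [intervalIntegral.integral_sub (by simp) (by simp)]
      simp [hα, Real.sin_arcsin (by linarith : (-1 : ℝ) ≤ s) hs1]
      ring
    intro t ht
    rw [uIcc_of_le (by linarith)] at ht
    have h1 : Real.cos α ≤ Real.cos t := by
      rw [← Real.cos_abs t]
      exact Real.cos_le_cos_of_nonneg_of_le_pi (abs_nonneg t) (by linarith [Real.pi_pos])
        (abs_le.2 ht)
    have h2 : 0 ≤ Real.cos t := Real.cos_nonneg_of_mem_Icc ⟨by linarith [ht.1], by linarith [ht.2]⟩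
    simp [hh, abs_of_nonneg h2, h1]
  change ∫ θ in (0 : ℝ)..Real.pi, h (θ - b) = _
  rw [e1, ← intervalIntegral.integral_add_adjacent_intervals (i1 _ (-α)) (i1 _ _), z1,
    ← intervalIntegral.integral_add_adjacent_intervals (i1 _ α) (i1 _ _), z2, z3]
  ring

theorem measurableSet_abs_sin_le (s a : ℝ) : MeasurableSet {θ : ℝ | |Real.sin (θ - a)| ≤ s} :=
  (isClosed_le (by fun_prop) continuous_const).measurableSet

theorem intervalIntegrable_indicator_one {S : Set ℝ} (hS : MeasurableSet S) (u v : ℝ) :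
    IntervalIntegrable (S.indicator fun _ => (1 : ℝ)) volume u v := by
  rw [intervalIntegrable_iff]
  exact (integrableOn_const (by simp [uIoc])).indicator hS

theorem integral_indicator_abs_sin_le (s a : ℝ) (hs0 : 0 ≤ s) (hs1 : s ≤ 1) :
    ∫ θ in (0 : ℝ)..Real.pi, {θ : ℝ | |Real.sin (θ - a)| ≤ s}.indicator (fun _ => (1 : ℝ)) θ
      ≤ 2 * Real.arcsin s := by
  set h : ℝ → ℝ := {θ : ℝ | |Real.sin θ| ≤ s}.indicator (fun _ => (1 : ℝ)) with hh
  have hper : Function.Periodic h Real.pi := fun t => by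
    simp [hh, indicator, Real.sin_add_pi]
  have hα0 : 0 ≤ Real.arcsin s := Real.arcsin_nonneg.2 hs0
  change ∫ θ in (0 : ℝ)..Real.pi, h (θ - a) ≤ _
  have e1 : ∫ θ in (0 : ℝ)..Real.pi, h (θ - a) = ∫ t in (-(Real.pi / 2))..(Real.pi / 2), h t := by
    rw [intervalIntegral.integral_comp_sub_right]
    have := hper.intervalIntegral_add_eq (0 - a) (-(Real.pi / 2))
    convert this using 2 <;> ring
  have hm : MeasurableSet {θ : ℝ | |Real.sin θ| ≤ s} := by
    simpa using measurableSet_abs_sin_le s 0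
  rw [e1, intervalIntegral.integral_of_le (by linarith [Real.pi_pos]), hh,
    setIntegral_indicator hm]
  simp only [integral_const, smul_eq_mul, mul_one, MeasurableSet.univ, measureReal_restrict_apply,
    univ_inter]
  calc volume.real (Ioc (-(Real.pi / 2)) (Real.pi / 2) ∩ {θ : ℝ | |Real.sin θ| ≤ s})
      ≤ volume.real (Icc (-Real.arcsin s) (Real.arcsin s)) := by
        refine measureReal_mono ?_ (by simp)
        rintro t ⟨ht, hts⟩
        obtain ⟨h1, h2⟩ := abs_le.1 (show |Real.sin t| ≤ s from hts)
        have ht' : t ∈ Icc (-(Real.pi / 2)) (Real.pi / 2) := ⟨ht.1.le, ht.2⟩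
        constructor
        · rw [← Real.arcsin_neg]
          exact (Real.arcsin_le_iff_le_sin ⟨by linarith, by linarith⟩ ht').2 h1
        · exact (Real.le_arcsin_iff_sin_le ht' ⟨by linarith, by linarith⟩).2 h2
    _ = 2 * Real.arcsin s := by
        simp [Real.volume_real_Icc, hα0]; ring

/-- Bathtub principle: with `α = arcsin s`, a set of measure at most `2α` captures the most of
`|cos|` when centred at its peak, namely `2 sin α = 2s`. The phases `a` and `b` are therefore
irrelevant. -/
theorem lintegral_indicator_abs_sin_le {s ε : ℝ} (hs0 : 0 ≤ s) (hs1 : s ≤ 1) (hε : 0 ≤ ε)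
    (a b : ℝ) :
    ∫⁻ θ in Ioc 0 Real.pi, {θ : ℝ | |Real.sin (θ - a)| ≤ s}.indicator
      (fun θ => ENNReal.ofReal (|Real.cos (θ - b)| + ε)) θ ≤ ENNReal.ofReal (2 * s + ε * Real.pi) := by
  set c := Real.cos (Real.arcsin s) with hc
  have hc0 : 0 ≤ c := Real.cos_arcsin_nonneg s
  set S := {θ : ℝ | |Real.sin (θ - a)| ≤ s}
  have hS : MeasurableSet S := measurableSet_abs_sin_le s a
  -- On `S`, `|cos|` is at most its excess over the level `c` plus `c`. The integrals `2s - 2αc` and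
  -- at most `2αc` add up to at most `2s`.
  set G : ℝ → ℝ := fun θ => max (|Real.cos (θ - b)| - c) 0 + (c * S.indicator (fun _ => (1 : ℝ)) θ + ε)
    with hG
  have j1 : IntervalIntegrable (fun θ : ℝ => max (|Real.cos (θ - b)| - c) 0) volume 0 Real.pi :=
    Continuous.intervalIntegrable (by fun_prop) _ _
  have j2 := (intervalIntegrable_indicator_one hS 0 Real.pi).const_mul c
  have j3 : IntervalIntegrable (fun _ : ℝ => ε) volume 0 Real.pi := by simp
  have hGi : IntervalIntegrable G volume 0 Real.pi := j1.add (j2.add j3)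
  have hG0 : ∀ θ, 0 ≤ G θ := fun θ => by
    have : 0 ≤ S.indicator (fun _ => (1 : ℝ)) θ := indicator_nonneg (fun _ _ => zero_le_one) _
    positivity
  calc _ ≤ ∫⁻ θ in Ioc 0 Real.pi, ENNReal.ofReal (G θ) := by
        refine lintegral_mono fun θ => ?_
        by_cases h : θ ∈ S
        · rw [indicator_of_mem h]
          refine ENNReal.ofReal_le_ofReal ?_
          simp only [hG, indicator_of_mem h]
          linarith [le_max_left (|Real.cos (θ - b)| - c) 0]
        · rw [indicator_of_notMem h]; exact zero_le
    _ = ENNReal.ofReal (∫ θ in (0 : ℝ)..Real.pi, G θ) := by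
        rw [intervalIntegral.integral_of_le Real.pi_pos.le,
          ofReal_integral_eq_lintegral_ofReal]
        · exact (intervalIntegrable_iff_integrableOn_Ioc_of_le Real.pi_pos.le).1 hGi
        · exact Filter.Eventually.of_forall hG0
    _ ≤ _ := by
        refine ENNReal.ofReal_le_ofReal ?_
        rw [hG, intervalIntegral.integral_add j1 (j2.add j3), intervalIntegral.integral_add j2 j3,
          integral_max_abs_cos_sub hs0 hs1, intervalIntegral.integral_const_mul]
        have := mul_le_mul_of_nonneg_left (integral_indicator_abs_sin_le s a hs0 hs1) hc0
        simp only [intervalIntegral.integral_const, smul_eq_mul]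
        nlinarith

/-! ### Covering a rectifiable set by nearly straight pieces. -/

/-- All chords of `P` make a small angle with a fixed direction: in every direction `e` the set is
compressed essentially as much as that fixed direction is. -/
def IsNearlyStraight (ε : ℝ) (P : Set Plane) : Prop :=
  ∃ v : Plane, ‖v‖ = 1 ∧ ∀ p ∈ P, ∀ q ∈ P, ∀ e : Plane, ‖e‖ = 1 →
    |inner ℝ (p - q) e| ≤ (|inner ℝ v e| + ε) * ‖p - q‖

theorem IsNearlyStraight.closure {ε : ℝ} {P : Set Plane} (h : IsNearlyStraight ε P) :
    IsNearlyStraight ε (closure P) := by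
  obtain ⟨v, hv, h⟩ := h
  refine ⟨v, hv, fun p hp q hq e he => ?_⟩
  have hcl : IsClosed {x : Plane × Plane |
      |inner ℝ (x.1 - x.2) e| ≤ (|inner ℝ v e| + ε) * ‖x.1 - x.2‖} :=
    isClosed_le (by fun_prop) (by fun_prop)
  have hsub : P ×ˢ P ⊆ {x : Plane × Plane |
      |inner ℝ (x.1 - x.2) e| ≤ (|inner ℝ v e| + ε) * ‖x.1 - x.2‖} :=
    fun x hx => h x.1 hx.1 x.2 hx.2 e he
  have := hcl.closure_subset_iff.2 hsub
  rw [closure_prod_eq] at this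
  exact this (mk_mem_prod hp hq)

theorem isNearlyStraight_empty (ε : ℝ) : IsNearlyStraight ε ∅ :=
  ⟨EuclideanSpace.single 0 1, by simp, by simp⟩

theorem IsNearlyStraight.of_approximatesLinearOn {ε : ℝ} (hε0 : 0 < ε) (hε1 : ε ≤ 1)
    {f : ℝ → Plane} {A : ℝ →L[ℝ] Plane} {s : Set ℝ} {c : ℝ≥0} (hA : A 1 ≠ 0)
    (hc : (c : ℝ) ≤ ε / 3 * ‖A 1‖) (h : ApproximatesLinearOn f A s c) :
    IsNearlyStraight ε (f '' s) := by
  have hw : 0 < ‖A 1‖ := norm_pos_iff.2 hA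
  refine ⟨‖A 1‖⁻¹ • A 1, by rw [norm_smul, norm_inv, norm_norm, inv_mul_cancel₀ hw.ne'], ?_⟩
  rintro _ ⟨x, hx, rfl⟩ _ ⟨y, hy, rfl⟩ e he
  set d := f x - f y with hd
  set l := ‖A 1‖ * |x - y| with hl
  set k := |inner ℝ (‖A 1‖⁻¹ • A 1) e| with hk
  have hAxy : A (x - y) = (x - y) • A 1 := by
    rw [← map_smul, smul_eq_mul, mul_one]
  have hnA : ‖A (x - y)‖ = l := by rw [hAxy, norm_smul, Real.norm_eq_abs, mul_comm]
  have hr : ‖d - A (x - y)‖ ≤ ε / 3 * l := by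
    refine (h x hx y hy).trans ?_
    rw [Real.norm_eq_abs, hl]
    nlinarith [mul_le_mul_of_nonneg_right hc (abs_nonneg (x - y))]
  have hiA : |inner ℝ (A (x - y)) e| = l * k := by
    rw [hAxy, hl, hk, inner_smul_left, inner_smul_left, abs_mul, abs_mul]
    simp
    field_simp
  have hk0 : 0 ≤ k := abs_nonneg _
  have hk1 : k ≤ 1 := by
    refine (abs_real_inner_le_norm _ _).trans ?_
    rw [he, norm_smul, norm_inv, norm_norm, inv_mul_cancel₀ hw.ne', one_mul]
  have hl0 : 0 ≤ l := by positivity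
  have h1 : |inner ℝ d e| ≤ l * k + ε / 3 * l := by
    have : inner ℝ d e = inner ℝ (A (x - y)) e + inner ℝ (d - A (x - y)) e := by
      rw [← inner_add_left]; congr 1; abel
    rw [this, ← hiA]
    refine (abs_add_le _ _).trans (add_le_add le_rfl ?_)
    refine (abs_real_inner_le_norm _ _).trans ?_
    rwa [he, mul_one]
  have h2 : l * (1 - ε / 3) ≤ ‖d‖ := by
    have : ‖A (x - y)‖ ≤ ‖d‖ + ‖d - A (x - y)‖ := by
      have := norm_sub_le d (d - A (x - y)); simpa using this
    rw [hnA] at this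
    linarith
  refine h1.trans (le_trans ?_ (mul_le_mul_of_nonneg_left h2 (by positivity)))
  -- The constant `ε / 3` is chosen for this: `k ≤ 1` and `ε ≤ 1` bound the loss `(k + ε) ε / 3` by
  -- `2ε / 3`.
  have : k + ε / 3 ≤ (k + ε) * (1 - ε / 3) := by nlinarith
  nlinarith

theorem volume_inner_image_eq_zero {K : ℝ≥0} {f : ℝ → Plane} {T N : Set ℝ}
    (hf : LipschitzOnWith K f T) (hN : N ⊆ T) (hN0 : volume N = 0) (e : Plane) :
    volume ((fun p : Plane => inner ℝ p e) '' (f '' N)) = 0 := by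
  have hL : LipschitzWith ‖e‖₊ (fun p : Plane => (inner ℝ p e : ℝ)) := by
    refine LipschitzWith.of_dist_le_mul fun p q => ?_
    rw [Real.dist_eq, ← inner_sub_left, dist_eq_norm, mul_comm]
    exact abs_real_inner_le_norm _ _
  rw [← image_comp]
  have := (hL.comp_lipschitzOnWith (hf.mono hN)).hausdorffMeasure_image_le (d := 1) zero_le_one
  rw [hausdorffMeasure_real, hN0, mul_zero] at this
  exact le_antisymm this zero_le

theorem volume_inner_image_eq_zero_of_hasDerivWithinAt {f : ℝ → Plane} {Z : Set ℝ}
    (hf : ∀ x ∈ Z, HasDerivWithinAt f 0 Z x) (e : Plane) :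
    volume ((fun p : Plane => inner ℝ p e) '' (f '' Z)) = 0 := by
  rw [← image_comp]
  refine addHaar_image_eq_zero_of_det_fderivWithin_eq_zero (f' := fun _ => 0) volume
    (fun x hx => ?_) (fun x _ => ?_)
  · have := (hf x hx).inner ℝ (hasDerivWithinAt_const x Z e)
    simpa [Function.comp_def] using this.hasFDerivWithinAt
  · simp [ContinuousLinearMap.det]

/-- Non-differentiability points are null by Rademacher, and critical points have null projections
by Sard. Near the remaining points `f` is almost linear with nonzero slope, so countably many nearly
straight pieces suffice. -/
theorem exists_isNearlyStraight_cover_of_lipschitzOnWith {ε : ℝ} (hε0 : 0 < ε) (hε1 : ε ≤ 1)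
    {K : ℝ≥0} {f : ℝ → Plane} {T : Set ℝ} (hf : LipschitzOnWith K f T) :
    ∃ P : ℕ → Set Plane, (∀ n, IsClosed (P n) ∧ IsNearlyStraight ε (P n)) ∧
      ∀ e : Plane, volume ((fun p : Plane => inner ℝ p e) '' (f '' T \ ⋃ n, P n)) = 0 := by
  classical
  set N := {x ∈ T | ¬ DifferentiableWithinAt ℝ f T x} with hN
  set Z := {x ∈ T | HasDerivWithinAt f 0 T x} with hZ
  set R := {x ∈ T | DifferentiableWithinAt ℝ f T x ∧ fderivWithin ℝ f T x 1 ≠ 0} with hR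
  have hT : T ⊆ N ∪ Z ∪ R := by
    intro x hx
    by_cases h1 : DifferentiableWithinAt ℝ f T x
    · by_cases h2 : fderivWithin ℝ f T x 1 = 0
      · refine Or.inl (Or.inr ⟨hx, ?_⟩)
        have := h1.hasFDerivWithinAt.hasDerivWithinAt
        rwa [h2] at this
      · exact Or.inr ⟨hx, h1, h2⟩
    · exact Or.inl (Or.inl ⟨hx, h1⟩)
  have hN0 : volume N = 0 := by
    have := hf.ae_differentiableWithinAt_of_mem_real
    rw [ae_iff] at this
    refine measure_mono_null (fun x hx => ?_) this
    exact fun h => hx.2 (h hx.1)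
  obtain ⟨P, hP, hPR⟩ : ∃ P : ℕ → Set Plane, (∀ n, IsClosed (P n) ∧ IsNearlyStraight ε (P n)) ∧
      f '' R ⊆ ⋃ n, P n := by
    rcases R.eq_empty_or_nonempty with hRe | hRn
    · exact ⟨fun _ => ∅, fun _ => ⟨isClosed_empty, isNearlyStraight_empty ε⟩, by simp [hRe]⟩
    have hd : ∀ x ∈ R, HasFDerivWithinAt f (fderivWithin ℝ f T x) R x := fun x hx =>
      hx.2.1.hasFDerivWithinAt.mono (sep_subset _ _)
    obtain ⟨t, A, -, hcov, happ, hA⟩ := exists_closed_cover_approximatesLinearOn_of_hasFDerivWithinAt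
      f R (fderivWithin ℝ f T) hd
      -- The value 1 only keeps the tolerance nonzero: every `A n` is a derivative at a point of
      -- `R`, where `A 1 ≠ 0`.
      (fun A => if A 1 = 0 then 1 else Real.toNNReal (ε / 3 * ‖A 1‖)) (fun A => by
        split_ifs with h
        · exact one_ne_zero
        · have : 0 < ‖A 1‖ := norm_pos_iff.2 h
          exact (Real.toNNReal_pos.2 (by positivity)).ne')
    refine ⟨fun n => closure (f '' (R ∩ t n)), fun n => ⟨isClosed_closure, ?_⟩, ?_⟩
    · obtain ⟨y, hy, hAy⟩ := hA hRn n
      have hA1 : A n 1 ≠ 0 := by rw [hAy]; exact hy.2.2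
      refine (IsNearlyStraight.of_approximatesLinearOn hε0 hε1 hA1 ?_ (happ n)).closure
      rw [if_neg hA1, Real.coe_toNNReal _ (by positivity)]
    · rintro _ ⟨x, hx, rfl⟩
      obtain ⟨n, hn⟩ := mem_iUnion.1 (hcov hx)
      exact mem_iUnion.2 ⟨n, subset_closure (mem_image_of_mem f ⟨hx, hn⟩)⟩
  refine ⟨P, hP, fun e => ?_⟩
  have hsub : f '' T \ ⋃ n, P n ⊆ f '' N ∪ f '' Z := by
    rintro _ ⟨⟨x, hx, rfl⟩, hxP⟩
    rcases hT hx with (h | h) | h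
    · exact Or.inl ⟨x, h, rfl⟩
    · exact Or.inr ⟨x, h, rfl⟩
    · exact absurd (hPR ⟨x, h, rfl⟩) hxP
  refine measure_mono_null (image_mono hsub) ?_
  rw [image_union]
  exact measure_union_null (volume_inner_image_eq_zero hf (sep_subset _ _) hN0 e)
    (volume_inner_image_eq_zero_of_hasDerivWithinAt
      (fun x hx => hx.2.mono (sep_subset _ _)) e)

/-- Arc length is the parameter; `T` is the set of its attained values. -/
theorem IsRectifiableCurve.exists_lipschitzOnWith {C : Set Plane} (hC : IsRectifiableCurve C) :
    ∃ (f : ℝ → Plane) (T : Set ℝ), LipschitzOnWith 1 f T ∧ C = f '' T := by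
  obtain ⟨γ, -, hbv, rfl⟩ := hC
  have h0 : (0 : ℝ) ∈ Icc (0 : ℝ) 1 := by simp
  have hl := hbv.locallyBoundedVariationOn
  refine ⟨naturalParameterization γ (Icc 0 1) 0, variationOnFromTo γ (Icc 0 1) 0 '' Icc 0 1, ?_, ?_⟩
  · have hu := has_unit_speed_naturalParameterization γ hl h0
    have key : ∀ x ∈ variationOnFromTo γ (Icc 0 1) 0 '' Icc 0 1,
        ∀ y ∈ variationOnFromTo γ (Icc 0 1) 0 '' Icc 0 1, x ≤ y →
        edist (naturalParameterization γ (Icc 0 1) 0 x) (naturalParameterization γ (Icc 0 1) 0 y)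
          ≤ edist x y := by
      intro x hx y hy hxy
      have := hu hx hy
      rw [NNReal.coe_one, one_mul] at this
      rw [edist_comm x y, edist_dist y x, Real.dist_eq, abs_of_nonneg (sub_nonneg.2 hxy), ← this]
      exact eVariationOn.edist_le _ ⟨hx, left_mem_Icc.2 hxy⟩ ⟨hy, right_mem_Icc.2 hxy⟩
    intro x hx y hy
    rw [ENNReal.coe_one, one_mul]
    rcases le_total x y with h | h
    · exact key x hx y hy h
    · rw [edist_comm, edist_comm x]
      exact key y hy x hx h
  · rw [← image_comp]
    refine image_congr fun b hb => ?_
    exact (edist_eq_zero.1 (edist_naturalParameterization_eq_zero hl h0 hb)).symm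

theorem IsRectifiable.exists_isNearlyStraight_cover {B : Set Plane} (hB : IsRectifiable B)
    {ε : ℝ} (hε0 : 0 < ε) (hε1 : ε ≤ 1) :
    ∃ P : ℕ → Set Plane, (∀ n, IsClosed (P n) ∧ IsNearlyStraight ε (P n)) ∧
      ∀ e : Plane, volume ((fun p : Plane => inner ℝ p e) '' (B \ ⋃ n, P n)) = 0 := by
  obtain ⟨S, hS, hSC, rfl⟩ := hB
  rcases S.eq_empty_or_nonempty with rfl | hne
  · exact ⟨fun _ => ∅, fun _ => ⟨isClosed_empty, isNearlyStraight_empty ε⟩, by simp⟩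
  obtain ⟨c, rfl⟩ := hS.exists_eq_range hne
  have : ∀ m, ∃ P : ℕ → Set Plane, (∀ n, IsClosed (P n) ∧ IsNearlyStraight ε (P n)) ∧
      ∀ e : Plane, volume ((fun p : Plane => inner ℝ p e) '' (c m \ ⋃ n, P n)) = 0 := by
    intro m
    obtain ⟨f, T, hf, hfT⟩ := (hSC _ (mem_range_self m)).exists_lipschitzOnWith
    rw [hfT]
    exact exists_isNearlyStraight_cover_of_lipschitzOnWith hε0 hε1 hf
  choose P hP hP0 using this
  refine ⟨fun n => P n.unpair.1 n.unpair.2, fun n => hP _ _, fun e => ?_⟩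
  refine measure_mono_null ?_ (measure_iUnion_null fun m => hP0 m e)
  rw [← image_iUnion, sUnion_range]
  refine image_mono ?_
  rintro x ⟨hx, hxP⟩
  obtain ⟨m, hm⟩ := mem_iUnion.1 hx
  refine mem_iUnion.2 ⟨m, hm, fun h => hxP ?_⟩
  obtain ⟨n, hn⟩ := mem_iUnion.1 h
  exact mem_iUnion.2 ⟨Nat.pair m n, by simpa using hn⟩

theorem IsRectifiable.measurableSet {B : Set Plane} (hB : IsRectifiable B) : MeasurableSet B := by
  obtain ⟨S, hS, hSC, rfl⟩ := hB
  refine MeasurableSet.sUnion hS fun C hC => ?_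
  obtain ⟨γ, hγ, -, rfl⟩ := hSC C hC
  exact (isCompact_Icc.image_of_continuousOn hγ).measurableSet

/-! ### Crofton-type upper bound for the lines hit. -/

/-- The unit vector of the plane at angle `θ`. -/
noncomputable def unitVec (θ : ℝ) : Plane := !₂[Real.cos θ, Real.sin θ]

theorem norm_unitVec (θ : ℝ) : ‖unitVec θ‖ = 1 := by
  simp [unitVec, EuclideanSpace.norm_eq, Fin.sum_univ_two]

@[fun_prop]
theorem continuous_unitVec : Continuous unitVec := by
  unfold unitVec
  fun_prop

theorem exists_inner_unitVec_eq (x : Plane) :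
    ∃ a : ℝ, ∀ θ, inner ℝ x (unitVec θ) = ‖x‖ * Real.cos (θ - a) := by
  set z : ℂ := ⟨x 0, x 1⟩ with hz
  have hn : ‖z‖ = ‖x‖ := by
    rw [Complex.norm_eq_sqrt_sq_add_sq, EuclideanSpace.norm_eq]
    simp [hz, Fin.sum_univ_two]
  refine ⟨z.arg, fun θ => ?_⟩
  have h1 : ‖z‖ * Real.cos z.arg = x 0 := Complex.norm_mul_cos_arg z
  have h2 : ‖z‖ * Real.sin z.arg = x 1 := Complex.norm_mul_sin_arg z
  have h3 : inner ℝ x (unitVec θ) = x 0 * Real.cos θ + x 1 * Real.sin θ := by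
    simp [unitVec, PiLp.inner_apply, Fin.sum_univ_two, mul_comm]
  rw [h3, ← h1, ← h2, ← hn, Real.cos_sub]
  ring

/-- The points of the plane whose normal line to the direction `θ` meets the unit disc. -/
def strip (θ : ℝ) : Set Plane := {x | |inner ℝ x (unitVec θ)| ≤ 1}

theorem measurableSet_strip (θ : ℝ) : MeasurableSet (strip θ) :=
  (isClosed_le (by fun_prop) continuous_const).measurableSet

/-- The lines normal to direction `θ` which meet both the disc and `D`, given by their offsets. -/
def hitOffsets (D : Set Plane) (θ : ℝ) : Set ℝ :=
  (fun p : Plane => inner ℝ p (unitVec θ)) '' (D ∩ strip θ)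

/-- Weight of the point `x` in direction `θ` for a nearly straight set of direction `v`. -/
noncomputable def stripWeight (v : Plane) (ε : ℝ) (z : ℝ × Plane) : ℝ≥0∞ :=
  {z : ℝ × Plane | z.2 ∈ strip z.1}.indicator
    (fun z => ENNReal.ofReal (|inner ℝ v (unitVec z.1)| + ε)) z

theorem measurable_stripWeight (v : Plane) (ε : ℝ) : Measurable (stripWeight v ε) := by
  refine Measurable.indicator (ENNReal.continuous_ofReal.comp (by fun_prop)).measurable ?_
  exact (isClosed_le (f := fun z : ℝ × Plane => |inner ℝ z.2 (unitVec z.1)|)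
    (by fun_prop) continuous_const).measurableSet

/-- Used with `s = 1` for the inner part and `s = (1 + r)⁻¹` for the outer part. -/
theorem lintegral_stripWeight_le {s ε : ℝ} (hs0 : 0 ≤ s) (hs1 : s ≤ 1) (hε : 0 ≤ ε) {v x : Plane}
    (hv : ‖v‖ = 1) (hx : s = 1 ∨ 1 ≤ s * ‖x‖) :
    ∫⁻ θ in Ioc 0 Real.pi, stripWeight v ε (θ, x) ≤ ENNReal.ofReal (2 * s + ε * Real.pi) := by
  obtain ⟨a, ha⟩ := exists_inner_unitVec_eq x
  obtain ⟨b, hb⟩ := exists_inner_unitVec_eq v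
  refine le_trans (lintegral_mono fun θ => ?_)
    (lintegral_indicator_abs_sin_le hs0 hs1 hε (a - Real.pi / 2) b)
  by_cases h : x ∈ strip θ
  · have h1 : ‖x‖ * |Real.cos (θ - a)| ≤ 1 := by
      have : |inner ℝ x (unitVec θ)| ≤ 1 := h
      rwa [ha, abs_mul, abs_norm] at this
    have h2 : |Real.cos (θ - a)| ≤ s := by
      rcases hx with rfl | hx
      · exact Real.abs_cos_le_one _
      · have hx0 : 0 < ‖x‖ := by
          rcases (norm_nonneg x).eq_or_lt with h0 | h0
          · rw [← h0, mul_zero] at hx; linarith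
          · exact h0
        nlinarith
    have h3 : θ ∈ {θ : ℝ | |Real.sin (θ - (a - Real.pi / 2))| ≤ s} := by
      have : θ - (a - Real.pi / 2) = θ - a + Real.pi / 2 := by ring
      rwa [mem_ofPred_eq, this, Real.sin_add_pi_div_two]
    rw [indicator_of_mem h3, stripWeight, indicator_of_mem (by exact h), hb, hv, one_mul]
  · rw [stripWeight, indicator_of_notMem (by exact h)]
    exact zero_le

theorem volume_hitOffsets_le {ε : ℝ} (hε : 0 ≤ ε) {v : Plane} {A : Set Plane}
    (hA : ∀ p ∈ A, ∀ q ∈ A, ∀ e : Plane, ‖e‖ = 1 →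
      |inner ℝ (p - q) e| ≤ (|inner ℝ v e| + ε) * ‖p - q‖) (θ : ℝ) :
    volume (hitOffsets A θ) ≤ ∫⁻ x in A, stripWeight v ε (θ, x) ∂μH[1] := by
  set k : ℝ := |inner ℝ v (unitVec θ)| + ε with hk
  have hk0 : 0 ≤ k := by positivity
  have hL : LipschitzOnWith k.toNNReal (fun p : Plane => (inner ℝ p (unitVec θ) : ℝ))
      (A ∩ strip θ) := by
    refine LipschitzOnWith.of_dist_le_mul fun p hp q hq => ?_
    rw [Real.dist_eq, ← inner_sub_left, dist_eq_norm, Real.coe_toNNReal _ hk0]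
    exact hA p hp.1 q hq.1 _ (norm_unitVec θ)
  have h1 := hL.hausdorffMeasure_image_le (d := 1) zero_le_one
  rw [hausdorffMeasure_real, ENNReal.rpow_one] at h1
  refine h1.trans (le_of_eq ?_)
  have : ∀ x, stripWeight v ε (θ, x) = (strip θ).indicator (fun _ => ENNReal.ofReal k) x :=
    fun x => rfl
  simp_rw [this]
  rw [lintegral_indicator (measurableSet_strip θ), lintegral_const, Measure.restrict_apply_univ,
    Measure.restrict_apply (measurableSet_strip θ), inter_comm]
  rfl

/-- Tonelli, applied to a measurable majorant `G` so that measurability of `θ ↦ volume (hitOffsets A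
θ)` is never needed. -/
theorem exists_measurable_bound_hitOffsets_of_isNearlyStraight {s ε : ℝ} (hs0 : 0 ≤ s)
    (hs1 : s ≤ 1) (hε : 0 ≤ ε) {A : Set Plane} (hA : MeasurableSet A) (hfin : μH[1] A ≠ ∞)
    (hAs : ∀ x ∈ A, s = 1 ∨ 1 ≤ s * ‖x‖) {P : Set Plane} (hP : IsNearlyStraight ε P)
    (hAP : A ⊆ P) :
    ∃ G : ℝ → ℝ≥0∞, Measurable G ∧ (∀ θ, volume (hitOffsets A θ) ≤ G θ) ∧
      ∫⁻ θ in Ioc 0 Real.pi, G θ ≤ ENNReal.ofReal (2 * s + ε * Real.pi) * μH[1] A := by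
  obtain ⟨v, hv, hPv⟩ := hP
  have : IsFiniteMeasure ((μH[1] : Measure Plane).restrict A) :=
    ⟨by rw [Measure.restrict_apply_univ]; exact hfin.lt_top⟩
  have hm := measurable_stripWeight v ε
  refine ⟨fun θ => ∫⁻ x in A, stripWeight v ε (θ, x) ∂μH[1], hm.lintegral_prod_right',
    fun θ => volume_hitOffsets_le hε (fun p hp q hq => hPv p (hAP hp) q (hAP hq)) θ, ?_⟩
  rw [lintegral_lintegral_swap (f := fun θ x => stripWeight v ε (θ, x)) hm.aemeasurable]
  calc _ ≤ ∫⁻ _ in A, ENNReal.ofReal (2 * s + ε * Real.pi) ∂(μH[1] : Measure Plane) :=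
        setLIntegral_mono' hA fun x hx => lintegral_stripWeight_le hs0 hs1 hε hv (hAs x hx)
    _ = _ := by rw [lintegral_const, Measure.restrict_apply_univ]

/-- A one-sided Crofton inequality for the lines meeting the unit disc. -/
theorem exists_measurable_bound_hitOffsets {s ε : ℝ} (hs0 : 0 ≤ s) (hs1 : s ≤ 1) (hε0 : 0 < ε)
    (hε1 : ε ≤ 1) {B D : Set Plane} (hB : IsRectifiable B) (hDB : D ⊆ B) (hD : MeasurableSet D)
    (hfin : μH[1] D ≠ ∞) (hDs : ∀ x ∈ D, s = 1 ∨ 1 ≤ s * ‖x‖) :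
    ∃ G : ℝ → ℝ≥0∞, Measurable G ∧ (∀ θ, volume (hitOffsets D θ) ≤ G θ) ∧
      ∫⁻ θ in Ioc 0 Real.pi, G θ ≤ ENNReal.ofReal (2 * s + ε * Real.pi) * μH[1] D := by
  obtain ⟨P, hP, hP0⟩ := hB.exists_isNearlyStraight_cover hε0 hε1
  -- Disjoint pieces, so that their lengths sum to at most that of `D`.
  set A : ℕ → Set Plane := fun n => D ∩ disjointed P n with hA
  have hAm : ∀ n, MeasurableSet (A n) := fun n =>
    hD.inter (MeasurableSet.disjointed (fun i => (hP i).1.measurableSet) n)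
  have hAD : ∀ n, A n ⊆ D := fun n => inter_subset_left
  have hAU : ⋃ n, A n = D ∩ ⋃ n, P n := by rw [← inter_iUnion, iUnion_disjointed]
  have hdisj : Pairwise (Function.onFun Disjoint A) := fun m n hmn =>
    (disjoint_disjointed P hmn).mono inter_subset_right inter_subset_right
  have := fun n => exists_measurable_bound_hitOffsets_of_isNearlyStraight hs0 hs1 hε0.le (hAm n)
    (ne_top_of_le_ne_top hfin (measure_mono (hAD n))) (fun x hx => hDs x (hAD n hx)) (hP n).2
    (inter_subset_right.trans (disjointed_subset P n))
  choose G hG hGle hGint using this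
  refine ⟨fun θ => ∑' n, G n θ, Measurable.tsum hG, fun θ => ?_, ?_⟩
  · have hsub : hitOffsets D θ ⊆ (⋃ n, hitOffsets (A n) θ) ∪
        (fun p : Plane => inner ℝ p (unitVec θ)) '' (B \ ⋃ n, P n) := by
      rintro _ ⟨x, ⟨hxD, hxs⟩, rfl⟩
      by_cases hx : x ∈ ⋃ n, P n
      · have : x ∈ ⋃ n, A n := by rw [hAU]; exact ⟨hxD, hx⟩
        obtain ⟨n, hn⟩ := mem_iUnion.1 this
        exact Or.inl (mem_iUnion.2 ⟨n, x, ⟨hn, hxs⟩, rfl⟩)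
      · exact Or.inr ⟨x, ⟨hDB hxD, hx⟩, rfl⟩
    calc volume (hitOffsets D θ) ≤ volume (⋃ n, hitOffsets (A n) θ) + 0 := by
          rw [← hP0 (unitVec θ)]
          exact (measure_mono hsub).trans (measure_union_le _ _)
      _ ≤ ∑' n, volume (hitOffsets (A n) θ) := by rw [add_zero]; exact measure_iUnion_le _
      _ ≤ _ := ENNReal.tsum_le_tsum fun n => hGle n θ
  · rw [lintegral_tsum fun n => (hG n).aemeasurable]
    refine (ENNReal.tsum_le_tsum hGint).trans ?_
    rw [ENNReal.tsum_mul_left, ← measure_iUnion hdisj hAm]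
    gcongr
    exact iUnion_subset hAD

/-! ### The barrier property and the final inequality. -/

theorem IsBarrier.Icc_subset_hitOffsets {B : Set Plane} (hB : IsBarrier B unitDisc) (θ : ℝ) :
    Icc (-1) 1 ⊆ hitOffsets B θ := by
  intro t ht
  set e := unitVec θ with he
  have hen : ‖e‖ = 1 := norm_unitVec θ
  have he0 : e ≠ 0 := norm_ne_zero_iff.1 (by rw [hen]; exact one_ne_zero)
  have : Fact (Module.finrank ℝ Plane = 1 + 1) := ⟨by simp⟩
  -- The line normal to `e` at offset `t` meets the disc at `t • e`.
  obtain ⟨b, hbl, hbB⟩ := hB (AffineSubspace.mk' (t • e) (ℝ ∙ e)ᗮ)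
    (by rw [AffineSubspace.direction_mk']; exact Submodule.finrank_orthogonal_span_singleton he0)
    ⟨t • e, AffineSubspace.self_mem_mk' _ _, by
      rw [unitDisc, mem_closedBall_zero_iff, norm_smul, hen, mul_one]
      exact abs_le.2 ht⟩
  have hb : inner ℝ b e = t := by
    have h1 := (AffineSubspace.mem_mk').1 hbl
    rw [vsub_eq_sub, Submodule.mem_orthogonal_singleton_iff_inner_left, inner_sub_left,
      inner_smul_left, real_inner_self_eq_norm_sq, hen] at h1
    simp at h1
    linarith
  exact ⟨b, ⟨hbB, by rw [strip, mem_ofPred_eq, ← he, hb]; exact abs_le.2 ht⟩, hb⟩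

theorem mem_smul_unitDisc_iff {r : ℝ} (hr : 0 ≤ r) (x : Plane) :
    x ∈ (1 + r) • unitDisc ↔ ‖x‖ ≤ 1 + r := by
  rw [unitDisc, smul_closedBall _ _ zero_le_one]
  simp [abs_of_nonneg (by linarith : 0 ≤ 1 + r)]

theorem IsRectifiable.measurableSet_outerPart {B : Set Plane} (hB : IsRectifiable B) (r : ℝ) :
    MeasurableSet (outerPart B r) := by
  refine hB.measurableSet.diff ?_
  rw [unitDisc, smul_closedBall _ _ zero_le_one]
  exact Metric.isClosed_closedBall.measurableSet

theorem pi_le_of_isBarrier {r : ℝ} (hr : 0 ≤ r) {B : Set Plane} (hrect : IsRectifiable B)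
    (hB : IsBarrier B unitDisc) (hfin : μH[1] B ≠ ∞) :
    Real.pi ≤ (μH[1] (B \ outerPart B r)).toReal + (μH[1] (outerPart B r)).toReal / (1 + r) := by
  have hOB : outerPart B r ⊆ B := sdiff_subset
  have hOm : MeasurableSet (outerPart B r) := hrect.measurableSet_outerPart r
  have hIm := hrect.measurableSet.diff hOm
  have hOf := ne_top_of_le_ne_top hfin (measure_mono hOB)
  have hIf := ne_top_of_le_ne_top hfin (measure_mono (sdiff_subset : B \ outerPart B r ⊆ B))
  set I := (μH[1] (B \ outerPart B r)).toReal with hI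
  set O := (μH[1] (outerPart B r)).toReal with hO
  have hr1 : 0 < 1 + r := by linarith
  have hs1 : (1 + r)⁻¹ ≤ 1 := inv_le_one_of_one_le₀ (by linarith)
  have key : ∀ ε : ℝ, 0 < ε → ε ≤ 1 →
      2 * Real.pi ≤ (2 * 1 + ε * Real.pi) * I + (2 * (1 + r)⁻¹ + ε * Real.pi) * O := by
    intro ε hε0 hε1
    obtain ⟨G, hG, hGle, hGint⟩ := exists_measurable_bound_hitOffsets zero_le_one le_rfl hε0 hε1
      hrect sdiff_subset hIm hIf fun _ _ => Or.inl rfl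
    obtain ⟨H, hH, hHle, hHint⟩ := exists_measurable_bound_hitOffsets (inv_nonneg.2 hr1.le) hs1
      hε0 hε1 hrect hOB hOm hOf fun x hx => Or.inr (by
        have : 1 + r < ‖x‖ := not_le.1 fun h => hx.2 ((mem_smul_unitDisc_iff hr x).2 h)
        rw [inv_mul_eq_div, one_le_div hr1]
        exact this.le)
    have h2 : ∀ θ, 2 ≤ G θ + H θ := by
      intro θ
      calc (2 : ℝ≥0∞) = volume (Icc (-1 : ℝ) 1) := by rw [Real.volume_Icc]; norm_num
        _ ≤ volume (hitOffsets (B \ outerPart B r) θ ∪ hitOffsets (outerPart B r) θ) := by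
            refine measure_mono ((hB.Icc_subset_hitOffsets θ).trans ?_)
            rw [hitOffsets, hitOffsets, hitOffsets, ← image_union, ← union_inter_distrib_right,
              sdiff_union_of_subset hOB]
        _ ≤ _ := (measure_union_le _ _).trans (add_le_add (hGle θ) (hHle θ))
    have h3 : ENNReal.ofReal (2 * Real.pi) ≤
        ENNReal.ofReal (2 * 1 + ε * Real.pi) * μH[1] (B \ outerPart B r) +
        ENNReal.ofReal (2 * (1 + r)⁻¹ + ε * Real.pi) * μH[1] (outerPart B r) := by
      calc ENNReal.ofReal (2 * Real.pi) = ∫⁻ _ in Ioc 0 Real.pi, (2 : ℝ≥0∞) := by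
            rw [lintegral_const, Measure.restrict_apply_univ, Real.volume_Ioc, sub_zero,
              ENNReal.ofReal_mul zero_le_two, ENNReal.ofReal_ofNat]
        _ ≤ ∫⁻ θ in Ioc 0 Real.pi, (G θ + H θ) := lintegral_mono h2
        _ = _ := lintegral_add_left hG _
        _ ≤ _ := add_le_add hGint hHint
    have hI0 : 0 ≤ I := ENNReal.toReal_nonneg
    have hO0 : 0 ≤ O := ENNReal.toReal_nonneg
    have hpi := Real.pi_pos
    rw [← ENNReal.ofReal_toReal hIf, ← ENNReal.ofReal_toReal hOf,
      ← ENNReal.ofReal_mul (by positivity), ← ENNReal.ofReal_mul (by positivity),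
      ← ENNReal.ofReal_add (by positivity) (by positivity)] at h3
    exact (ENNReal.ofReal_le_ofReal_iff (by positivity)).1 h3
  -- Both lengths are finite and independent of `ε`, so `ε` may tend to 0.
  have hlim : Filter.Tendsto
      (fun ε : ℝ => (2 * 1 + ε * Real.pi) * I + (2 * (1 + r)⁻¹ + ε * Real.pi) * O)
      (nhdsWithin 0 (Ioi 0)) (nhds ((2 * 1 + 0 * Real.pi) * I + (2 * (1 + r)⁻¹ + 0 * Real.pi) * O)) :=
    ((Continuous.tendsto (by fun_prop) 0)).mono_left nhdsWithin_le_nhds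
  have := ge_of_tendsto hlim (by
    filter_upwards [Ioc_mem_nhdsGT (zero_lt_one' ℝ)] with ε hε using key ε hε.1 hε.2)
  rw [div_eq_mul_inv]
  linarith

theorem proposition2 (r : ℝ) (hr : 0 ≤ r) (B : Set Plane) (hrect : IsRectifiable B)
    (hB : IsBarrier B unitDisc) :
    ENNReal.ofReal Real.pi + ENNReal.ofReal (r / (1 + r)) * setLength (outerPart B r)
      ≤ setLength B := by
  unfold setLength
  by_cases hfin : μH[1] B = ∞
  · rw [hfin]; exact le_top
  have hOB : outerPart B r ⊆ B := sdiff_subset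
  have hOm : MeasurableSet (outerPart B r) := hrect.measurableSet_outerPart r
  have hOf := ne_top_of_le_ne_top hfin (measure_mono hOB)
  have hIf := ne_top_of_le_ne_top hfin (measure_mono (sdiff_subset : B \ outerPart B r ⊆ B))
  have hr1 : 0 < 1 + r := by linarith
  have key := pi_le_of_isBarrier hr hrect hB hfin
  rw [← sdiff_union_of_subset hOB, measure_union disjoint_sdiff_left hOm, sdiff_union_of_subset hOB,
    ← ENNReal.ofReal_toReal hOf, ← ENNReal.ofReal_toReal hIf,
    ← ENNReal.ofReal_mul (by positivity), ← ENNReal.ofReal_add Real.pi_pos.le (by positivity),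
    ← ENNReal.ofReal_add (by positivity) (by positivity)]
  refine ENNReal.ofReal_le_ofReal ?_
  set O := (μH[1] (outerPart B r)).toReal
  have : r / (1 + r) * O + O / (1 + r) = O := by field_simp; ring
  linarith
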